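/- Let $X$ be a complex Banach space, let $L(X)$ be the algebra of bounded linear operators on $X$, and write $N(S)$ and $R(S)$ for the kernel and the range of $S\in L(X)$. An operator $T\in L(X)$ is called *meromorphic* if $0$ is the only possible accumulation point of the spectrum $\sigma(T)$ and every non-zero isolated point of $\sigma(T)$ is a pole of the resolvent $\mu\mapsto (T-\mu I)^{-1}$. An operator $S\in L(X)$ is *of topological uniform descent* if there is $d\in\mathbb{N}=\{0,1,2,\dots\}$ such that $R(S)+N(S^n)=R(S)+N(S^d)$ for all $n\ge d$ and $R(S)+N(S^d)$ is closed in $X$. The operator $S$ is *B-Fredholm* if there is $n\in\mathbb{N}$ such that $R(S^n)$ is closed and the operator $S_n:R(S^n)\to R(S^n)$, $x\mapsto Sx$, is Fredholm (that is, $\dim N(S_n)<\infty$ and $\operatorname{codim} R(S_n)<\infty$). Put $$\sigma_{TUD}(T)=\{\lambda\in\mathbb{C} : T-\lambda I \text{ is not of topological uniform descent}\},$$ $$\sigma_{BF}(T)=\{\lambda\in\mathbb{C} : T-\lambda I \text{ is not B-Fredholm}\}.$$ **Theorem.** For every $T\in L(X)$ the following conditions are equivalent: 1. $T$ is a meromorphic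 operator; 2. $\sigma_{TUD}(T)\subseteq\{0\}$; 3. $\sigma_{BF}(T)\subseteq\{0\}$. -/

import Mathlib

open Filter Topology

section Fredholm

/-- On Banach spaces, Mathlib's Fredholm operators are exactly the bounded operators whose
nullity `dim N(u)` and defect `codim R(u)` are both finite. -/
theorem isFredholm_iff_finite_nullity_and_defect {Y Z : Type*}
    [NormedAddCommGroup Y] [NormedSpace ℂ Y] [CompleteSpace Y]
    [NormedAddCommGroup Z] [NormedSpace ℂ Z] [CompleteSpace Z] (u : Y →L[ℂ] Z) :
    u.IsFredholm ↔ FiniteDimensional ℂ u.ker ∧ FiniteDimensional ℂ (Z ⧸ u.range) := by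
  refine ⟨fun h => ⟨h.finite_ker, h.finite_coker⟩, fun ⟨hk, hc⟩ => ?_⟩
  have hcompl : u.ker.ClosedComplemented := Submodule.ClosedComplemented.of_finiteDimensional _
  have hclosed : IsClosed (u.range : Set Z) := by
    obtain ⟨K, hK, hKc⟩ := hcompl.exists_isClosed_isCompl
    have : CompleteSpace K := hK.completeSpace_coe
    obtain ⟨G, hG⟩ := u.range.exists_isCompl
    have hGfin : FiniteDimensional ℂ G :=
      Module.Finite.equiv (Submodule.quotientEquivOfIsCompl _ _ hG)
    have hrange : (u.comp K.subtypeL).range = u.range := by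
      apply le_antisymm
      · rintro _ ⟨y, rfl⟩
        exact ⟨y, rfl⟩
      · rintro _ ⟨y, rfl⟩
        obtain ⟨a, ha, b, hb, rfl⟩ :=
          Submodule.mem_sup.mp (hKc.sup_eq_top ▸ Submodule.mem_top : y ∈ u.ker ⊔ K)
        have ha' : u a = 0 := ha
        exact ⟨⟨b, hb⟩, by simp [ha']⟩
    have hker : (u.comp K.subtypeL).ker = ⊥ := by
      rw [LinearMap.ker_eq_bot']
      intro y hy
      exact Subtype.ext (Submodule.disjoint_def.mp hKc.disjoint y hy y.2)
    rw [← hrange]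
    exact ContinuousLinearMap.closed_complemented_range_of_isCompl_of_ker_eq_bot _ G
      (hrange.symm ▸ hG) G.closed_of_finiteDimensional hker
  have : CompleteSpace u.range := hclosed.completeSpace_coe
  refine ⟨?_, hclosed, hk, hc, hcompl⟩
  exact ContinuousLinearMap.isQuotientMap (u.codRestrict u.range fun x => ⟨x, rfl⟩)
    (fun ⟨_, x, hx⟩ => ⟨x, Subtype.ext hx⟩)

end Fredholm

section Descent

variable {X : Type*} [NormedAddCommGroup X] [NormedSpace ℂ X]

/-- `T` has uniform descent for `n ≥ d`: `R(T) + N(T ^ n) = R(T) + N(T ^ d)` for all `n ≥ d`. -/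
def HasUniformDescentFrom (T : X →L[ℂ] X) (d : ℕ) : Prop :=
  ∀ n : ℕ, d ≤ n → T.range ⊔ (T ^ n).ker = T.range ⊔ (T ^ d).ker

/-- `T` has topological uniform descent for `n ≥ d`: it has uniform descent for `n ≥ d` and
`R(T) + N(T ^ d)` is closed. -/
def HasTopologicalUniformDescentFrom (T : X →L[ℂ] X) (d : ℕ) : Prop :=
  HasUniformDescentFrom T d ∧ IsClosed ((T.range ⊔ (T ^ d).ker : Submodule ℂ X) : Set X)

/-- `T` is an operator of topological uniform descent. -/
def IsTopologicalUniformDescent (T : X →L[ℂ] X) : Prop :=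
  ∃ d : ℕ, HasTopologicalUniformDescentFrom T d

/-- The topological uniform descent spectrum `σ_TUD(T)`. -/
def tudSpectrum (T : X →L[ℂ] X) : Set ℂ :=
  {z | ¬ IsTopologicalUniformDescent (T - z • (1 : X →L[ℂ] X))}

end Descent

section BFredholm

variable {X : Type*} [NormedAddCommGroup X] [NormedSpace ℂ X]

/-- `T` maps the range of `T ^ n` into itself. -/
theorem map_mem_range_pow (T : X →L[ℂ] X) (n : ℕ) :
    ∀ x ∈ (T ^ n).range, T x ∈ (T ^ n).range := by
  rintro _ ⟨y, rfl⟩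
  exact ⟨T y, congrArg (fun S : X →L[ℂ] X => S y) (pow_mul_comm' T n)⟩

/-- The operator `T_n : R(T ^ n) → R(T ^ n)` induced by `T`. -/
def rangePowRestrict (T : X →L[ℂ] X) (n : ℕ) : (T ^ n).range →L[ℂ] (T ^ n).range :=
  T.restrict (map_mem_range_pow T n)

/-- `T` is a B-Fredholm operator: for some `n`, the range `R(T ^ n)` is closed and the operator
`T_n` induced by `T` on the Banach space `R(T ^ n)` is Fredholm. -/
def IsBFredholm (T : X →L[ℂ] X) : Prop :=
  ∃ n : ℕ, IsClosed ((T ^ n).range : Set X) ∧ (rangePowRestrict T n).IsFredholm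

/-- The B-Fredholm spectrum `σ_BF(T)`. -/
def bFredholmSpectrum (T : X →L[ℂ] X) : Set ℂ :=
  {z | ¬ IsBFredholm (T - z • (1 : X →L[ℂ] X))}

end BFredholm

section MeromorphicOperator

variable {X : Type*} [NormedAddCommGroup X] [NormedSpace ℂ X]

/-- The point `z` is a pole of the resolvent of `T`: it is an isolated point of the spectrum at
which the resolvent function (with values in the bounded operators) is meromorphic of negative
order. Mathlib's `resolvent T w` is `(w • 1 - T)⁻¹` on the resolvent set. -/
def IsPoleOfResolvent (T : X →L[ℂ] X) (z : ℂ) : Prop :=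
  z ∈ spectrum ℂ T ∧ ¬ AccPt z (𝓟 (spectrum ℂ T)) ∧
    MeromorphicAt (fun w : ℂ => resolvent T w) z ∧
    meromorphicOrderAt (fun w : ℂ => resolvent T w) z < 0

/-- `T` is a meromorphic operator: `0` is the only possible accumulation point of the spectrum and
every nonzero isolated point of the spectrum is a pole of the resolvent. -/
def IsMeromorphicOperator (T : X →L[ℂ] X) : Prop :=
  (∀ z : ℂ, AccPt z (𝓟 (spectrum ℂ T)) → z = 0) ∧
    ∀ z ∈ spectrum ℂ T, z ≠ 0 → ¬ AccPt z (𝓟 (spectrum ℂ T)) → IsPoleOfResolvent T z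

end MeromorphicOperator

/-! Write `S = T - z`. The deep implication is 2 → 1. If `S` has topological uniform descent from
`d`, it induces a semi-regular operator `A` on `X / N(S ^ d)`. At a boundary point of the spectrum,
`A - u` is invertible for arbitrarily small `u`, which forces `A` to be invertible
(`isUnit_of_frequently_isUnit_sub_smul`); the resolvent of `T` is then `(w - z) ^ (-d)` times an
analytic function (`isPoleOfResolvent_of_semiconj`). So each nonzero boundary point is an isolated
pole, and connectedness of `ℂ \ {0}` excludes nonzero interior points.

For 1 → 3, comparing Laurent coefficients at a pole gives `S ^ n = S ^ (n + 1) * B` with `B`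
commuting with `S`, so `S` is bijective on the closed space `R(S ^ n)`. For 3 → 2, `X / (R(S) + N(S
^ n))` embeds in the finite-dimensional cokernel of `S_n`, so the descent chain stabilizes. -/

/-! ### Invertibility of semi-regular operators under small perturbations. -/

section SemiRegular

variable {Y : Type*} [NormedAddCommGroup Y] [NormedSpace ℂ Y] [CompleteSpace Y]

/-- An operator with closed range admits bounded preimages of the points of its range. -/
theorem exists_preimage_norm_le_of_isClosed_range (A : Y →L[ℂ] Y)
    (hA : IsClosed (A.range : Set Y)) :
    ∃ C > 0, ∀ y ∈ A.range, ∃ x, A x = y ∧ ‖x‖ ≤ C * ‖y‖ := by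
  have : CompleteSpace A.range := hA.completeSpace_coe
  obtain ⟨C, hC, h⟩ := ContinuousLinearMap.exists_preimage_norm_le
    (A.codRestrict A.range fun x => ⟨x, rfl⟩) (fun ⟨_, x, hx⟩ => ⟨x, Subtype.ext hx⟩)
  refine ⟨C, hC, fun y hy => ?_⟩
  obtain ⟨x, hx, hn⟩ := h ⟨y, hy⟩
  exact ⟨x, congrArg Subtype.val hx, hn⟩

/-- A semi-regular operator (closed range containing the kernels of all powers) is injective if
arbitrarily small perturbations `A - z` of it are. -/
theorem injective_of_frequently_injective_sub_smul (A : Y →L[ℂ] Y)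
    (hA : IsClosed (A.range : Set Y)) (hker : ∀ m : ℕ, (A ^ m).ker ≤ A.range)
    (hz : ∃ᶠ z : ℂ in 𝓝 0, Function.Injective (A - z • (1 : Y →L[ℂ] Y))) :
    Function.Injective A := by
  obtain ⟨C, hC, hpre⟩ := exists_preimage_norm_le_of_isClosed_range A hA
  choose! g hg hgn using hpre
  refine (injective_iff_map_eq_zero A).2 fun x hx => ?_
  -- A backward orbit of `x`: each term is killed by a power of `A`, hence lies in the range and has
  -- a controlled preimage.
  have hstep : ∀ k : ℕ, (A ^ (k + 1)) (g^[k] x) = 0 ∧ ‖g^[k] x‖ ≤ C ^ k * ‖x‖ := by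
    intro k
    induction k with
    | zero => simpa using hx
    | succ k ih =>
      have hmem : g^[k] x ∈ A.range := hker (k + 1) ih.1
      rw [Function.iterate_succ_apply']
      refine ⟨?_, (hgn _ hmem).trans ?_⟩
      · rw [pow_succ, mul_apply_eq_comp, hg _ hmem, ih.1]
      · rw [pow_succ', mul_assoc]
        exact mul_le_mul_of_nonneg_left ih.2 hC.le
  have hA' : ∀ k, A (g^[k + 1] x) = g^[k] x := fun k => by
    rw [Function.iterate_succ_apply']
    exact hg _ (hker (k + 1) (hstep k).1)
  have hsmall : ∀ᶠ z : ℂ in 𝓝 0, ‖z‖ * C < 1 / 2 := by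
    have : Tendsto (fun z : ℂ => ‖z‖ * C) (𝓝 0) (𝓝 (‖(0 : ℂ)‖ * C)) :=
      (continuous_norm.mul continuous_const).tendsto 0
    exact this.eventually_lt_const (by norm_num)
  obtain ⟨z, hinj, hzC⟩ := (hz.and_eventually hsmall).exists
  have hq0 : 0 ≤ ‖z‖ * C := by positivity
  have hbound : ∀ k, ‖z ^ k • g^[k] x‖ ≤ (‖z‖ * C) ^ k * ‖x‖ := fun k => by
    rw [norm_smul, norm_pow, mul_pow, mul_assoc]
    exact mul_le_mul_of_nonneg_left (hstep k).2 (by positivity)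
  have hgeom : HasSum (fun k => (‖z‖ * C) ^ k * ‖x‖) ((1 - ‖z‖ * C)⁻¹ * ‖x‖) :=
    (hasSum_geometric_of_lt_one hq0 (by linarith)).mul_right _
  have hsum : Summable fun k => z ^ k • g^[k] x := .of_norm_bounded hgeom.summable hbound
  have hsucc := hsum.tsum_eq_zero_add
  -- The generating series of the backward orbit is an eigenvector for `z`, so it vanishes by
  -- injectivity of `A - z`. Then `x` is minus the tail, whose norm is less than `‖x‖` because the
  -- ratio is below `1 / 2`.
  have hfix : A (∑' k, z ^ k • g^[k] x) = z • ∑' k, z ^ k • g^[k] x := by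
    rw [hsucc, map_add, A.map_tsum ((summable_nat_add_iff 1).2 hsum), ← hsucc,
      ← hsum.tsum_const_smul]
    simp only [pow_zero, one_smul, Function.iterate_zero, id_eq, hx, zero_add, map_smul, hA',
      pow_succ', mul_smul]
  have hzero : ∑' k, z ^ k • g^[k] x = 0 := hinj (by simp [hfix])
  have hgeom' : HasSum (fun k => (‖z‖ * C) ^ (k + 1) * ‖x‖)
      ((1 - ‖z‖ * C)⁻¹ * ‖x‖ - ‖x‖) := by
    simpa using (hasSum_nat_add_iff' 1).2 hgeom
  have htail : ‖∑' k, z ^ (k + 1) • g^[k + 1] x‖ ≤ (1 - ‖z‖ * C)⁻¹ * ‖x‖ - ‖x‖ :=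
    tsum_of_norm_bounded hgeom' fun k => hbound (k + 1)
  have hx' : ‖x‖ ≤ (1 - ‖z‖ * C)⁻¹ * ‖x‖ - ‖x‖ := by
    have : x = -∑' k, z ^ (k + 1) • g^[k + 1] x := by
      rw [hzero] at hsucc
      simpa using eq_neg_of_add_eq_zero_left hsucc.symm
    rwa [← norm_neg, ← this] at htail
  have hinv : (1 - ‖z‖ * C)⁻¹ < 2 := by
    rw [inv_lt_comm₀ (by linarith) (by norm_num)]
    linarith
  by_contra hne
  have : 0 < ‖x‖ := norm_pos_iff.2 hne
  nlinarith

/-- A semi-regular operator is invertible if arbitrarily small perturbations `A - z` of it are. -/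
theorem isUnit_of_frequently_isUnit_sub_smul (A : Y →L[ℂ] Y)
    (hA : IsClosed (A.range : Set Y)) (hker : ∀ m : ℕ, (A ^ m).ker ≤ A.range)
    (hz : ∃ᶠ z : ℂ in 𝓝 0, IsUnit (A - z • (1 : Y →L[ℂ] Y))) : IsUnit A := by
  have hinj : Function.Injective A := injective_of_frequently_injective_sub_smul A hA hker
    (hz.mono fun z h => (ContinuousLinearMap.isUnit_iff_bijective.1 h).1)
  refine ContinuousLinearMap.isUnit_iff_bijective.2 ⟨hinj, fun y => ?_⟩
  obtain ⟨C, hC, hpre⟩ := exists_preimage_norm_le_of_isClosed_range A hA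
  have hbelow : ∀ x, ‖x‖ ≤ C * ‖A x‖ := fun x => by
    obtain ⟨x', hx', hn⟩ := hpre (A x) ⟨x, rfl⟩
    rwa [hinj hx'] at hn
  -- The range is closed, so density suffices: if `(A - z) x = y`, then `A x` misses `y` by `z • x`,
  -- with `‖x‖` bounded independently of `z`.
  refine hA.closure_subset_iff.2 subset_rfl (Metric.mem_closure_iff.2 fun ε hε => ?_)
  have hsmall : ∀ᶠ z : ℂ in 𝓝 0, ‖z‖ * C < 1 / 2 ∧ ‖z‖ * (2 * C * ‖y‖) < ε := by
    have h : ∀ D : ℝ, Tendsto (fun z : ℂ => ‖z‖ * D) (𝓝 0) (𝓝 (‖(0 : ℂ)‖ * D)) := fun D =>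
      (continuous_norm.mul continuous_const).tendsto 0
    exact ((h C).eventually_lt_const (by norm_num)).and
      ((h _).eventually_lt_const (by simpa using hε))
  obtain ⟨z, hunit, hz1, hz2⟩ := (hz.and_eventually hsmall).exists
  obtain ⟨x, hx⟩ := (ContinuousLinearMap.isUnit_iff_bijective.1 hunit).2 y
  have hx' : A x = y + z • x := by
    rw [← hx]; simp
  have hxn : ‖x‖ ≤ 2 * C * ‖y‖ := by
    have h1 := hbelow x
    have h2 : ‖A x‖ ≤ ‖y‖ + ‖z‖ * ‖x‖ := by
      rw [hx', ← norm_smul]; exact norm_add_le _ _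
    have h3 : C * ‖A x‖ ≤ C * (‖y‖ + ‖z‖ * ‖x‖) := mul_le_mul_of_nonneg_left h2 hC.le
    have h4 := norm_nonneg x
    nlinarith
  refine ⟨A x, ⟨x, rfl⟩, ?_⟩
  rw [hx', dist_eq_norm, sub_add_cancel_left, norm_neg, norm_smul]
  exact (mul_le_mul_of_nonneg_left hxn (norm_nonneg z)).trans_lt hz2

end SemiRegular

/-! ### Passing to the quotient by the kernel of a power. -/

section Semiconj

variable {X Y : Type*} [NormedAddCommGroup X] [NormedSpace ℂ X]
  [NormedAddCommGroup Y] [NormedSpace ℂ Y]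

theorem sub_smul_apply_of_semiconj {S : X →L[ℂ] X} {A : Y →L[ℂ] Y} {p : X →L[ℂ] Y}
    (hp : ∀ x, p (S x) = A (p x)) (u : ℂ) (x : X) :
    (A - u • (1 : Y →L[ℂ] Y)) (p x) = p ((S - u • (1 : X →L[ℂ] X)) x) := by
  simp [hp]

theorem commute_sub_smul_one_pow (S : X →L[ℂ] X) (u : ℂ) (d : ℕ) :
    Commute (S ^ d) (S - u • (1 : X →L[ℂ] X)) :=
  ((Commute.refl S).sub_right ((Commute.one_right S).smul_right u)).pow_left d

variable [CompleteSpace X] [CompleteSpace Y]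

/-- Invertibility of `S - u` passes to the operator induced modulo the kernel of a power. -/
theorem isUnit_sub_smul_of_semiconj {S : X →L[ℂ] X} {A : Y →L[ℂ] Y} {p : X →L[ℂ] Y} {d : ℕ}
    (hp : ∀ x, p (S x) = A (p x)) (hsurj : Function.Surjective p)
    (hker : ∀ x, p x = 0 ↔ (S ^ d) x = 0) {u : ℂ} (hu : IsUnit (S - u • (1 : X →L[ℂ] X))) :
    IsUnit (A - u • (1 : Y →L[ℂ] Y)) := by
  rw [ContinuousLinearMap.isUnit_iff_bijective] at hu ⊢
  refine ⟨(injective_iff_map_eq_zero _).2 fun y hy => ?_, fun y => ?_⟩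
  · obtain ⟨x, rfl⟩ := hsurj y
    rw [sub_smul_apply_of_semiconj hp, hker, ← mul_apply_eq_comp,
      (commute_sub_smul_one_pow S u d).eq, mul_apply_eq_comp] at hy
    exact (hker x).2 ((injective_iff_map_eq_zero _).1 hu.1 _ hy)
  · obtain ⟨x, rfl⟩ := hsurj y
    obtain ⟨x', rfl⟩ := hu.2 x
    exact ⟨p x', sub_smul_apply_of_semiconj hp u x'⟩

/-- Invertibility of `S - u`, for `u ≠ 0`, can be checked modulo the kernel of a power of `S`. -/
theorem isUnit_sub_smul_of_semiconj_of_ne_zero {S : X →L[ℂ] X} {A : Y →L[ℂ] Y} {p : X →L[ℂ] Y}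
    {d : ℕ} (hp : ∀ x, p (S x) = A (p x)) (hsurj : Function.Surjective p)
    (hker : ∀ x, p x = 0 ↔ (S ^ d) x = 0) {u : ℂ} (hu0 : u ≠ 0)
    (hu : IsUnit (A - u • (1 : Y →L[ℂ] Y))) : IsUnit (S - u • (1 : X →L[ℂ] X)) := by
  have hcomm : Commute S (u • (1 : X →L[ℂ] X)) := (Commute.one_right S).smul_right u
  have hpow : (u • (1 : X →L[ℂ] X)) ^ d = u ^ d • 1 := by rw [smul_pow, one_pow]
  have hud : u ^ d ≠ 0 := pow_ne_zero d hu0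
  rw [ContinuousLinearMap.isUnit_iff_bijective] at hu ⊢
  refine ⟨(injective_iff_map_eq_zero _).2 fun x hx => ?_, fun y => ?_⟩
  · have hpx : p x = 0 := (injective_iff_map_eq_zero _).1 hu.1 _ (by
      rw [sub_smul_apply_of_semiconj hp, hx, map_zero])
    have h := congrArg (fun B : X →L[ℂ] X => B x) (hcomm.geom_sum₂_mul d)
    rw [hpow] at h
    simp only [mul_apply_eq_comp, hx, map_zero, sub_apply,
      (hker x).1 hpx] at h
    simpa [hud] using h
  · obtain ⟨y', hy'⟩ := hu.2 (p y)
    obtain ⟨x, rfl⟩ := hsurj y'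
    rw [sub_smul_apply_of_semiconj hp, ← sub_eq_zero, ← map_sub, hker] at hy'
    -- The defect `n` is killed by `S ^ d`, so the geometric sum `q` satisfies `(S - u) q = -u ^ d •
    -- n`, and `q / u ^ d` corrects it.
    set n := (S - u • (1 : X →L[ℂ] X)) x - y with hn
    have h := congrArg (fun B : X →L[ℂ] X => B n) (hcomm.mul_geom_sum₂ d)
    rw [hpow] at h
    simp only [mul_apply_eq_comp, sub_apply (S ^ d), hy'] at h
    set q := (∑ i ∈ Finset.range d, S ^ i * (u • (1 : X →L[ℂ] X)) ^ (d - 1 - i)) n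
    refine ⟨x + (u ^ d)⁻¹ • q, ?_⟩
    rw [map_add, map_smul, h]
    simp [hud, hn]

/-- If the operator induced by `T - z` modulo the kernel of `(T - z) ^ d` is invertible, then the
spectral value `z` is a pole of the resolvent of `T`. -/
theorem isPoleOfResolvent_of_semiconj {T : X →L[ℂ] X} {z : ℂ} (hz : z ∈ spectrum ℂ T)
    {A : Y →L[ℂ] Y} {p : X →L[ℂ] Y} {j : Y →L[ℂ] X} {d : ℕ}
    (hp : ∀ x, p ((T - z • (1 : X →L[ℂ] X)) x) = A (p x)) (hsurj : Function.Surjective p)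
    (hker : ∀ x, p x = 0 ↔ ((T - z • (1 : X →L[ℂ] X)) ^ d) x = 0)
    (hj : ∀ x, j (p x) = ((T - z • (1 : X →L[ℂ] X)) ^ d) x) (hA : IsUnit A) :
    IsPoleOfResolvent T z := by
  set S := T - z • (1 : X →L[ℂ] X) with hS
  have hshift : ∀ w, algebraMap ℂ (X →L[ℂ] X) w - T = (w - z) • 1 - S := fun w => by
    rw [Algebra.algebraMap_eq_smul_one, hS, sub_smul]; abel
  have hsub : Tendsto (fun w : ℂ => w - z) (𝓝 z) (𝓝 0) := by
    simpa using (continuous_sub_right z).tendsto z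
  have hAev : ∀ᶠ w in 𝓝 z, IsUnit ((w - z) • (1 : Y →L[ℂ] Y) - A) := by
    have hcont : Continuous fun w : ℂ => (w - z) • (1 : Y →L[ℂ] Y) - A := by fun_prop
    exact hcont.continuousAt.eventually_mem (Units.isOpen.mem_nhds (by simpa using hA))
  have hSev : ∀ᶠ w in 𝓝[≠] z, IsUnit (algebraMap ℂ (X →L[ℂ] X) w - T) := by
    filter_upwards [hAev.filter_mono nhdsWithin_le_nhds, self_mem_nhdsWithin] with w hw hwz
    rw [hshift, IsUnit.sub_iff]
    exact isUnit_sub_smul_of_semiconj_of_ne_zero hp hsurj hker (sub_ne_zero.2 hwz)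
      (IsUnit.sub_iff.1 hw)
  -- Geometric sum identity for `(w - z) ^ d - S ^ d`, times the resolvent; the remainder `S ^ d *
  -- resolvent T w` factors through the quotient and so stays analytic at `z`.
  have hmem : ∀ᶠ w in 𝓝[≠] z, resolvent T w = (w - z) ^ (-(d : ℤ)) •
      ((∑ i ∈ Finset.range d, (w - z) ^ i • S ^ (d - 1 - i)) +
        j.comp ((Ring.inverse ((w - z) • (1 : Y →L[ℂ] Y) - A)).comp p)) := by
    filter_upwards [hSev, hAev.filter_mono nhdsWithin_le_nhds, self_mem_nhdsWithin]
      with w hw hwA hwz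
    have hu : (w - z) ^ d ≠ 0 := pow_ne_zero d (sub_ne_zero.2 hwz)
    have hr : ((w - z) • 1 - S) * resolvent T w = 1 := by
      rw [← hshift]; exact Ring.mul_inverse_cancel _ hw
    have hgeom := (show Commute ((w - z) • (1 : X →L[ℂ] X)) S from
      (Commute.one_left S).smul_left _).geom_sum₂_mul d
    have hgeom' := congrArg (· * resolvent T w) hgeom
    simp only [mul_assoc, hr, mul_one, smul_pow, one_pow, smul_mul_assoc, one_mul,
      sub_mul] at hgeom'
    have hjp : S ^ d * resolvent T w =
        j.comp ((Ring.inverse ((w - z) • (1 : Y →L[ℂ] Y) - A)).comp p) := by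
      ext x
      have h1 : ((w - z) • (1 : Y →L[ℂ] Y) - A) (p (resolvent T w x)) = p x := by
        have := congrArg (fun B : X →L[ℂ] X => p (B x)) hr
        simpa [hp] using this
      have h2 := congrArg (fun B : Y →L[ℂ] Y => B (p (resolvent T w x)))
        (Ring.inverse_mul_cancel _ hwA)
      rw [mul_apply_eq_comp, ← hj]
      simp only [mul_apply_eq_comp, h1] at h2
      simp [h2]
    rw [hgeom', ← hjp, sub_add_cancel, zpow_neg, zpow_natCast, inv_smul_smul₀ hu]
  have hid : AnalyticAt ℂ (fun w : ℂ => w - z) z := by fun_prop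
  have hanA : AnalyticAt ℂ (fun w => Ring.inverse ((w - z) • (1 : Y →L[ℂ] Y) - A)) z := by
    have hlin : AnalyticAt ℂ (fun w : ℂ => (w - z) • (1 : Y →L[ℂ] Y) - A) z :=
      (hid.smul analyticAt_const).sub analyticAt_const
    have hunit : IsUnit ((z - z) • (1 : Y →L[ℂ] Y) - A) := by simpa using hA
    exact (analyticAt_inverse (𝕜 := ℂ) hunit.unit).comp_of_eq hlin rfl
  have han : AnalyticAt ℂ (fun w => (∑ i ∈ Finset.range d, (w - z) ^ i • S ^ (d - 1 - i)) +
      j.comp ((Ring.inverse ((w - z) • (1 : Y →L[ℂ] Y) - A)).comp p)) z := by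
    refine .add ?_ ?_
    · exact Finset.analyticAt_fun_sum _ fun i _ => (hid.pow i).smul analyticAt_const
    · exact ((ContinuousLinearMap.compL ℂ X Y X j).analyticAt _).comp
        ((((ContinuousLinearMap.compL ℂ X Y Y).flip p).analyticAt _).comp hanA)
  have hmero : MeromorphicAt (fun w : ℂ => resolvent T w) z :=
    ((hid.meromorphicAt.zpow _).smul han.meromorphicAt).congr
      (hmem.mono fun w hw => hw.symm)
  refine ⟨hz, ?_, hmero, ?_⟩
  · rw [accPt_iff_frequently_nhdsNE, not_frequently]
    exact hSev.mono fun w hw => not_not.2 hw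
  -- With nonnegative order the resolvent would have a limit at `z`, and that limit would invert `z
  -- - T`.
  · by_contra! hnn
    obtain ⟨B, hB⟩ := (tendsto_nhds_iff_meromorphicOrderAt_nonneg hmero).2 hnn
    have hcont : Tendsto (fun w => algebraMap ℂ (X →L[ℂ] X) w - T) (𝓝[≠] z)
        (𝓝 (algebraMap ℂ (X →L[ℂ] X) z - T)) :=
      ((continuous_algebraMap ℂ (X →L[ℂ] X)).sub continuous_const).continuousAt.mono_left
        nhdsWithin_le_nhds
    have h1 : (algebraMap ℂ (X →L[ℂ] X) z - T) * B = 1 :=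
      tendsto_nhds_unique (hcont.mul hB) (tendsto_const_nhds.congr' (hSev.mono fun w hw =>
        (Ring.mul_inverse_cancel _ hw).symm))
    have h2 : B * (algebraMap ℂ (X →L[ℂ] X) z - T) = 1 :=
      tendsto_nhds_unique (hB.mul hcont) (tendsto_const_nhds.congr' (hSev.mono fun w hw =>
        (Ring.inverse_mul_cancel _ hw).symm))
    exact hz ⟨⟨_, B, h1, h2⟩, rfl⟩

end Semiconj

/-! ### Poles from topological uniform descent. -/

section Poles

variable {X : Type*} [NormedAddCommGroup X] [NormedSpace ℂ X] [CompleteSpace X]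

/-- A boundary point of the spectrum at which `T - z` has topological uniform descent is a pole
of the resolvent. -/
theorem isPoleOfResolvent_of_isTopologicalUniformDescent {T : X →L[ℂ] X} {z : ℂ}
    (hz : z ∈ spectrum ℂ T) (hbd : ∃ᶠ w in 𝓝 z, w ∉ spectrum ℂ T)
    (htud : IsTopologicalUniformDescent (T - z • (1 : X →L[ℂ] X))) : IsPoleOfResolvent T z := by
  obtain ⟨d, hd, hclosed⟩ := htud
  set S := T - z • (1 : X →L[ℂ] X) with hS
  have hKc : IsClosed ((S ^ d).ker : Set X) := (S ^ d).isClosed_ker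
  have hinv : (S ^ d).ker ≤ ((S ^ d).ker.mkQL.comp S).ker := fun x hx => by
    have hx' : (S ^ d) x = 0 := hx
    simp only [LinearMap.mem_ker, ContinuousLinearMap.coe_coe, ContinuousLinearMap.comp_apply,
      Submodule.mkQL_apply, Submodule.mkQ_apply, Submodule.Quotient.mk_eq_zero]
    rw [← mul_apply_eq_comp, pow_mul_comm', mul_apply_eq_comp, hx', map_zero]
  set p := (S ^ d).ker.mkQL with hpdef
  set A : (X ⧸ (S ^ d).ker) →L[ℂ] (X ⧸ (S ^ d).ker) := (S ^ d).ker.liftQL (p.comp S) hinv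
  set j : (X ⧸ (S ^ d).ker) →L[ℂ] X := (S ^ d).ker.liftQL (S ^ d) le_rfl
  have hp : ∀ x, p (S x) = A (p x) := fun x => rfl
  have hj : ∀ x, j (p x) = (S ^ d) x := fun x => rfl
  have hsurj : Function.Surjective p := Submodule.mkQ_surjective _
  have hker : ∀ x, p x = 0 ↔ (S ^ d) x = 0 := fun x => Submodule.Quotient.mk_eq_zero _
  have hpm : ∀ m x, p ((S ^ m) x) = (A ^ m) (p x) := fun m => by
    induction m with
    | zero => simp
    | succ m ih => intro x; rw [pow_succ', pow_succ', mul_apply_eq_comp, hp, ih]; rfl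
  have hrange : ∀ x, p x ∈ A.range ↔ x ∈ S.range ⊔ (S ^ d).ker := fun x => by
    rw [Submodule.mem_sup]
    constructor
    · rintro ⟨y, hy⟩
      obtain ⟨y, rfl⟩ := hsurj y
      have hy' : p (S y) = p x := hy
      refine ⟨S y, ⟨y, rfl⟩, x - S y, ?_, by abel⟩
      exact (hker _).1 (by rw [map_sub, hy', sub_self])
    · rintro ⟨_, ⟨y, rfl⟩, k, hk, rfl⟩
      refine ⟨p y, ?_⟩
      rw [map_add, (hker k).2 hk, add_zero]
      rfl
  have hAclosed : IsClosed (A.range : Set (X ⧸ (S ^ d).ker)) := by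
    rw [← (S ^ d).ker.isQuotientMap_mkQL.isClosed_preimage]
    convert hclosed using 1
    ext x
    exact hrange x
  -- This is where uniform descent enters: `S ^ (d + m) x = 0` puts `x` in `R(S) + N(S ^ d)`.
  have hAker : ∀ m : ℕ, (A ^ m).ker ≤ A.range := fun m y hy => by
    obtain ⟨x, rfl⟩ := hsurj y
    have hx : p ((S ^ m) x) = 0 := (hpm m x).trans hy
    rw [hrange, ← hd (d + m) (Nat.le_add_right d m)]
    refine Submodule.mem_sup_right ?_
    rw [LinearMap.mem_ker, ContinuousLinearMap.coe_coe, pow_add, mul_apply_eq_comp]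
    exact (hker _).1 hx
  have hAunit : ∃ᶠ u : ℂ in 𝓝 0, IsUnit (A - u • 1) := by
    have hsub : Tendsto (fun w : ℂ => w - z) (𝓝 z) (𝓝 0) := by
      simpa using (continuous_sub_right z).tendsto z
    refine hsub.frequently (hbd.mono fun w hw => ?_)
    refine isUnit_sub_smul_of_semiconj hp hsurj hker ?_
    rw [spectrum.notMem_iff, Algebra.algebraMap_eq_smul_one, IsUnit.sub_iff] at hw
    convert hw using 1
    rw [hS, sub_smul]; abel
  exact isPoleOfResolvent_of_semiconj hz hp hsurj hker hj
    (isUnit_of_frequently_isUnit_sub_smul A hAclosed hAker hAunit)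

/-- A nonzero accumulation point of the spectrum cannot be a boundary point, since those are
isolated poles. Hence interior points and non-accumulation points split the connected set `ℂ \ {0}`
into disjoint open sets; the second contains all large `w`, so the first is empty. -/
theorem isMeromorphicOperator_of_tudSpectrum_subset {T : X →L[ℂ] X}
    (h : tudSpectrum T ⊆ {0}) : IsMeromorphicOperator T := by
  have hpole : ∀ z ∈ spectrum ℂ T, z ≠ 0 → (∃ᶠ w in 𝓝 z, w ∉ spectrum ℂ T) →
      IsPoleOfResolvent T z := fun z hz hz0 hbd =>
    isPoleOfResolvent_of_isTopologicalUniformDescent hz hbd (by_contra fun hn => hz0 (h hn))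
  have hacc : ∀ z, AccPt z (𝓟 (spectrum ℂ T)) → z ∈ spectrum ℂ T := fun z hz =>
    (spectrum.isClosed T).closure_subset (mem_closure_iff_clusterPt.2 hz.clusterPt)
  have hint : ∀ z ∈ interior (spectrum ℂ T), AccPt z (𝓟 (spectrum ℂ T)) := fun z hz => by
    rw [accPt_iff_frequently_nhdsNE]
    exact (Eventually.filter_mono nhdsWithin_le_nhds
      (mem_interior_iff_mem_nhds.1 hz)).frequently
  have hopen : IsOpen {z | ¬ AccPt z (𝓟 (spectrum ℂ T))} :=
    (isClosed_derivedSet (spectrum ℂ T)).isOpen_compl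
  have hconn : IsPreconnected ({0}ᶜ : Set ℂ) :=
    (isConnected_compl_singleton_of_one_lt_rank (by simp) 0).isPreconnected
  have hcover : ({0}ᶜ : Set ℂ) ⊆
      interior (spectrum ℂ T) ∪ {z | ¬ AccPt z (𝓟 (spectrum ℂ T))} := fun z hz0 => by
    by_cases hz : AccPt z (𝓟 (spectrum ℂ T))
    · refine .inl (by_contra fun hn => ?_)
      rw [mem_interior_iff_mem_nhds] at hn
      exact (hpole z (hacc z hz) hz0 (not_eventually.1 hn)).2.1 hz
    · exact .inr hz
  obtain ⟨w, hw⟩ : ∃ w : ℂ, ‖T‖ * ‖(1 : X →L[ℂ] X)‖ < ‖w‖ :=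
    NormedField.exists_lt_norm ℂ _
  have hw0 : w ≠ 0 := norm_pos_iff.1 (lt_of_le_of_lt (by positivity) hw)
  have hwσ : ¬ AccPt w (𝓟 (spectrum ℂ T)) := fun hacc' =>
    hw.not_ge (spectrum.norm_le_norm_mul_of_mem (hacc w hacc'))
  have hempty : ∀ z, z ≠ 0 → ¬ AccPt z (𝓟 (spectrum ℂ T)) := fun z hz0 hz => by
    have hzint : z ∈ interior (spectrum ℂ T) := (hcover hz0).resolve_right (not_not.2 hz)
    obtain ⟨v, -, hv1, hv2⟩ := hconn _ _ isOpen_interior hopen hcover ⟨z, hz0, hzint⟩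
      ⟨w, hw0, hwσ⟩
    exact hv2 (hint v hv1)
  refine ⟨fun z hz => by_contra fun hz0 => hempty z hz0 hz, fun z hz hz0 hz' => ?_⟩
  refine hpole z hz hz0 fun hn => hz' (hint z (mem_interior_iff_mem_nhds.2 ?_))
  simpa using hn

end Poles

/-! ### B-Fredholm operators have topological uniform descent. -/

section BFredholmDescent

variable {X : Type*} [NormedAddCommGroup X] [NormedSpace ℂ X]

/-- `R(S) + N(S ^ n)` is the preimage under `S ^ n` of the range of `S_n`, hence closed and of
finite codimension. Any larger subspace is closed too, and the increasing chain above it is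
eventually constant. -/
theorem IsBFredholm.isTopologicalUniformDescent {S : X →L[ℂ] X} (h : IsBFredholm S) :
    IsTopologicalUniformDescent S := by
  obtain ⟨n, hn, hF⟩ := h
  have : FiniteDimensional ℂ ((S ^ n).range ⧸ (rangePowRestrict S n).range) := hF.finite_coker
  set q : X →L[ℂ] (S ^ n).range := (S ^ n).codRestrict (S ^ n).range fun x => ⟨x, rfl⟩ with hq
  have hmem : ∀ x, x ∈ S.range ⊔ (S ^ n).ker ↔ q x ∈ (rangePowRestrict S n).range := fun x => by
    rw [Submodule.mem_sup]
    constructor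
    · rintro ⟨_, ⟨y, rfl⟩, k, hk, rfl⟩
      have hk' : (S ^ n) k = 0 := hk
      refine ⟨q y, Subtype.ext ?_⟩
      change S ((S ^ n) y) = (S ^ n) (S y + k)
      rw [map_add, hk', add_zero, ← mul_apply_eq_comp, ← mul_apply_eq_comp, pow_mul_comm']
    · rintro ⟨⟨_, y, rfl⟩, hy⟩
      have hy' : S ((S ^ n) y) = (S ^ n) x := congrArg Subtype.val hy
      refine ⟨S y, ⟨y, rfl⟩, x - S y, ?_, by abel⟩
      rw [LinearMap.mem_ker, ContinuousLinearMap.coe_coe, map_sub, ← hy', ← mul_apply_eq_comp,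
        ← mul_apply_eq_comp, pow_mul_comm', sub_self]
  have hclosed : IsClosed ((S.range ⊔ (S ^ n).ker : Submodule ℂ X) : Set X) := by
    convert hF.isClosed_range.preimage q.continuous using 1
    ext x
    exact hmem x
  have hfin : FiniteDimensional ℂ (X ⧸ (S.range ⊔ (S ^ n).ker)) := by
    have heq : S.range ⊔ (S ^ n).ker =
        ((rangePowRestrict S n).range.mkQ ∘ₗ (q : X →ₗ[ℂ] (S ^ n).range)).ker := by
      ext x
      rw [hmem]
      simp
    rw [heq]
    exact Submodule.CoFG.ker _
  have hmono : Monotone fun m => S.range ⊔ (S ^ m).ker :=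
    monotone_nat_of_le_succ fun m => sup_le_sup_left (fun x hx => by
      have hx' : (S ^ m) x = 0 := hx
      rw [LinearMap.mem_ker, ContinuousLinearMap.coe_coe, pow_succ', mul_apply_eq_comp, hx',
        map_zero]) _
  have hnoeth : IsNoetherian ℂ (X ⧸ (S.range ⊔ (S ^ n).ker)) := inferInstance
  obtain ⟨m, hm⟩ := monotone_stabilizes_iff_noetherian.2 hnoeth
    ⟨fun m => (S.range ⊔ (S ^ (n + m)).ker).map (S.range ⊔ (S ^ n).ker).mkQ,
      fun a b hab => Submodule.map_mono (hmono (Nat.add_le_add_left hab n))⟩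
  refine ⟨n + m, fun k hk => ?_,
    Submodule.isClosed_mono_of_finiteDimensional_quotient hclosed (hmono (Nat.le_add_right n m))⟩
  obtain ⟨l, rfl⟩ := Nat.exists_eq_add_of_le hk
  have h := congrArg (Submodule.comap (S.range ⊔ (S ^ n).ker).mkQ)
    (hm (m + l) (Nat.le_add_right m l))
  change Submodule.comap _ (Submodule.map _ _) = Submodule.comap _ (Submodule.map _ _) at h
  rw [Submodule.comap_map_mkQ, Submodule.comap_map_mkQ, sup_eq_right.2 (hmono (Nat.le_add_right n m)),
    sup_eq_right.2 (hmono (Nat.le_add_right n (m + l)))] at h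
  rw [add_assoc]
  exact h.symm

end BFredholmDescent

/-! ### Poles, Drazin invertibility and the B-Fredholm property. -/

section Drazin

variable {X : Type*} [NormedAddCommGroup X] [NormedSpace ℂ X]

/-- Drazin invertible operators are B-Fredholm. -/
theorem isBFredholm_of_commute_of_pow_eq [CompleteSpace X] {S B : X →L[ℂ] X} {n : ℕ}
    (hcomm : Commute S B) (h : S ^ n = S ^ (n + 1) * B) : IsBFredholm S := by
  have hpow : ∀ k, S ^ n = S ^ (n + k) * B ^ k := fun k => by
    induction k with
    | zero => simp
    | succ k ih =>
      calc S ^ n = S ^ n * S ^ k * B ^ k := by rw [← pow_add, ← ih]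
        _ = S ^ (n + 1) * B * S ^ k * B ^ k := by rw [← h]
        _ = S ^ (n + (k + 1)) * B ^ (k + 1) := by
          rw [mul_assoc (S ^ (n + 1)), (hcomm.pow_left k).symm.eq, ← mul_assoc, ← pow_add,
            mul_assoc, ← pow_succ']
          ring_nf
  have hclosed : IsClosed ((S ^ n).range : Set X) := by
    -- Since `S ^ n = S ^ (2 * n) * B ^ n`, the operator `S ^ n * B ^ n` is a projection onto `R(S ^
    -- n)`.
    have heq : (S ^ n).range = (1 - S ^ n * B ^ n).ker := by
      ext x
      simp only [LinearMap.mem_range, LinearMap.mem_ker, ContinuousLinearMap.coe_coe]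
      constructor
      · rintro ⟨y, rfl⟩
        rw [← mul_apply_eq_comp, sub_mul, one_mul, mul_assoc,
          (hcomm.pow_pow n n).symm.eq, ← mul_assoc, ← pow_add, ← hpow n, sub_self]
        rfl
      · intro hx
        refine ⟨(B ^ n) x, ?_⟩
        rw [sub_apply, sub_eq_zero] at hx
        exact hx.symm
    rw [heq]
    exact (1 - S ^ n * B ^ n).isClosed_ker
  have : CompleteSpace (S ^ n).range := hclosed.completeSpace_coe
  refine ⟨n, hclosed, (isFredholm_iff_finite_nullity_and_defect _).2 ⟨?_, ?_⟩⟩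
  · have hker : (rangePowRestrict S n).ker = ⊥ := by
      rw [LinearMap.ker_eq_bot']
      rintro ⟨_, x, rfl⟩ hx
      have hx' : S ((S ^ n) x) = 0 := congrArg Subtype.val hx
      refine Subtype.ext ?_
      change (S ^ n) x = 0
      rw [h, (hcomm.pow_left (n + 1)).eq, pow_succ', mul_apply_eq_comp, mul_apply_eq_comp, hx',
        map_zero]
    rw [hker]
    infer_instance
  · have hrange : (rangePowRestrict S n).range = ⊤ := by
      rw [LinearMap.range_eq_top]
      rintro ⟨_, x, rfl⟩
      refine ⟨⟨(S ^ n) (B x), B x, rfl⟩, Subtype.ext ?_⟩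
      change S ((S ^ n) (B x)) = (S ^ n) x
      conv_rhs => rw [h, pow_succ']
      rfl
    rw [hrange]
    infer_instance

theorem commute_of_eventually_commute {S : X →L[ℂ] X} {z : ℂ} {g : ℂ → X →L[ℂ] X}
    (hg : ContinuousAt g z) (hcomm : ∀ᶠ w in 𝓝[≠] z, Commute S (g w)) : Commute S (g z) := by
  have hlim : Tendsto g (𝓝[≠] z) (𝓝 (g z)) := hg.mono_left nhdsWithin_le_nhds
  exact tendsto_nhds_unique_of_eventuallyEq (hlim.const_mul S) (hlim.mul_const S) hcomm

theorem zero_sub_mul_eq_of_eventually {S E : X →L[ℂ] X} {z : ℂ} {g F : ℂ → X →L[ℂ] X}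
    (hg : ContinuousAt g z) (hF : Tendsto F (𝓝[≠] z) (𝓝 E))
    (heq : ∀ᶠ w in 𝓝[≠] z, ((w - z) • 1 - S) * g w = F w) : (0 - S) * g z = E := by
  have hsub : Tendsto (fun w : ℂ => (w - z) • (1 : X →L[ℂ] X) - S) (𝓝[≠] z) (𝓝 (0 - S)) := by
    have hc : Continuous fun w : ℂ => (w - z) • (1 : X →L[ℂ] X) - S := by fun_prop
    simpa using (hc.tendsto z).mono_left nhdsWithin_le_nhds
  exact tendsto_nhds_unique_of_eventuallyEq (hsub.mul (hg.mono_left nhdsWithin_le_nhds)) hF heq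

/-- If an analytic solution `g` of `(w - z - S) g(w) = (w - z) ^ m C + D` commuting with `S` exists
near `z` and `S ^ k D = 0`, then `S ^ (m + k) C` is divisible by `S ^ (m + k + 1)`. -/
theorem exists_pow_mul_eq_pow_succ_mul_of_analyticAt (S C : X →L[ℂ] X) (z : ℂ) (m : ℕ) :
    ∀ (k : ℕ) (D : X →L[ℂ] X) (g : ℂ → X →L[ℂ] X), AnalyticAt ℂ g z → S ^ k * D = 0 →
      (∀ᶠ w in 𝓝[≠] z, ((w - z) • 1 - S) * g w = (w - z) ^ m • C + D) →
      (∀ᶠ w in 𝓝[≠] z, Commute S (g w)) →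
      ∃ B, Commute S B ∧ S ^ (m + k) * C = S ^ (m + k + 1) * B := by
  induction m with
  | zero =>
    intro k D g hg hD heq hcomm
    have hS := commute_of_eventually_commute hg.continuousAt hcomm
    have h0 : (0 - S) * g z = C + D := zero_sub_mul_eq_of_eventually hg.continuousAt
      tendsto_const_nhds (heq.mono fun w hw => by simpa using hw)
    refine ⟨-g z, hS.neg_right, ?_⟩
    rw [zero_add, pow_succ, mul_assoc, mul_neg, ← neg_mul, ← zero_sub, h0, mul_add, hD, add_zero]
  | succ m ih =>
    intro k D g hg hD heq hcomm
    have hrhs : Tendsto (fun w : ℂ => (w - z) ^ (m + 1) • C + D) (𝓝[≠] z) (𝓝 D) := by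
      have hc : Continuous fun w : ℂ => (w - z) ^ (m + 1) • C + D := by fun_prop
      simpa using (hc.tendsto z).mono_left nhdsWithin_le_nhds
    have hS := commute_of_eventually_commute hg.continuousAt hcomm
    have h0 : (0 - S) * g z = D := zero_sub_mul_eq_of_eventually hg.continuousAt hrhs heq
    obtain ⟨P, hP⟩ := hg
    have hdiv : ∀ᶠ w in 𝓝[≠] z, dslope g z w = (w - z)⁻¹ • (g w - g z) := by
      filter_upwards [self_mem_nhdsWithin] with w hw
      rw [dslope_of_ne _ hw, slope_def_module]
    -- Subtracting `g z` and dividing by `w - z` lowers `m` by one; the new constant term is `-g z`,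
    -- and `S ^ (k + 1)` kills it because `-S * g z = D`.
    obtain ⟨B, hB, hEq⟩ := ih (k + 1) (-g z) (dslope g z)
      ⟨_, hP.has_fpower_series_dslope_fslope⟩
      (by
        rw [pow_succ, mul_assoc, mul_neg, ← neg_mul, ← zero_sub, h0, hD])
      (by
        filter_upwards [heq, hdiv, self_mem_nhdsWithin] with w hw hw' hwz
        have hne : w - z ≠ 0 := sub_ne_zero.2 hwz
        have h1 : ((w - z) • 1 - S) * g z = (w - z) • g z + D := by
          rw [← h0, sub_mul, sub_mul, smul_mul_assoc, one_mul, zero_mul, zero_sub, sub_eq_add_neg]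
        rw [hw', mul_smul_comm, mul_sub, hw, h1, add_sub_add_right_eq_sub, smul_sub,
          inv_smul_smul₀ hne, pow_succ', mul_smul, inv_smul_smul₀ hne, sub_eq_add_neg])
      (by
        filter_upwards [hcomm, hdiv] with w hw hw'
        rw [hw']
        exact (hw.sub_right hS).smul_right _)
    exact ⟨B, hB, by rw [add_right_comm m 1 k]; exact hEq⟩

theorem isBFredholm_of_isUnit [CompleteSpace X] {S : X →L[ℂ] X} (hS : IsUnit S) :
    IsBFredholm S := by
  obtain ⟨u, rfl⟩ := hS
  exact isBFredholm_of_commute_of_pow_eq (n := 0) (B := ↑u⁻¹)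
    (by rw [Commute, SemiconjBy, u.mul_inv, u.inv_mul]) (by simp)

theorem IsPoleOfResolvent.isBFredholm [CompleteSpace X] {T : X →L[ℂ] X} {z : ℂ}
    (h : IsPoleOfResolvent T z) : IsBFredholm (T - z • (1 : X →L[ℂ] X)) := by
  obtain ⟨-, hacc, ⟨n, hn⟩, -⟩ := h
  have hev : ∀ᶠ w in 𝓝[≠] z, IsUnit (algebraMap ℂ (X →L[ℂ] X) w - T) := by
    rw [accPt_iff_frequently_nhdsNE, not_frequently] at hacc
    exact hacc.mono fun w hw => not_not.1 hw
  have hshift : ∀ w, algebraMap ℂ (X →L[ℂ] X) w - T =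
      (w - z) • 1 - (T - z • (1 : X →L[ℂ] X)) := fun w => by
    rw [Algebra.algebraMap_eq_smul_one, sub_smul]; abel
  -- Here `g w = (w - z) ^ n • resolvent T w`, with `C = 1`, `D = 0` and `k = 0`.
  obtain ⟨B, hB, hEq⟩ := exists_pow_mul_eq_pow_succ_mul_of_analyticAt
    (T - z • (1 : X →L[ℂ] X)) 1 z n 0 0 _ hn (mul_zero _)
    (hev.mono fun w hw => by
      rw [mul_smul_comm, ← hshift, add_zero]
      exact congrArg _ (Ring.mul_inverse_cancel _ hw))
    (hev.mono fun w hw => by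
      refine Commute.smul_right ?_ _
      obtain ⟨u, hu⟩ := hw
      change Commute _ (Ring.inverse (algebraMap ℂ (X →L[ℂ] X) w - T))
      rw [← hu, Ring.inverse_unit]
      refine Commute.units_inv_right ?_
      rw [hu, hshift]
      exact ((Commute.one_right _).smul_right _).sub_right (Commute.refl _))
  exact isBFredholm_of_commute_of_pow_eq hB (by simpa using hEq)

theorem bFredholmSpectrum_subset_of_isMeromorphicOperator [CompleteSpace X] {T : X →L[ℂ] X}
    (h : IsMeromorphicOperator T) : bFredholmSpectrum T ⊆ {0} := by
  refine fun z hz => by_contra fun hz0 => hz ?_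
  by_cases hσ : z ∈ spectrum ℂ T
  · exact (h.2 z hσ hz0 fun hacc => hz0 (h.1 z hacc)).isBFredholm
  · rw [spectrum.notMem_iff, Algebra.algebraMap_eq_smul_one, IsUnit.sub_iff] at hσ
    exact isBFredholm_of_isUnit hσ

end Drazin

theorem mainTheorem5 {X : Type*} [NormedAddCommGroup X] [NormedSpace ℂ X] [CompleteSpace X]
    (T : X →L[ℂ] X) :
    List.TFAE [IsMeromorphicOperator T, tudSpectrum T ⊆ {0}, bFredholmSpectrum T ⊆ {0}] := by
  tfae_have 1 → 3 := bFredholmSpectrum_subset_of_isMeromorphicOperator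
  tfae_have 3 → 2 := fun h z hz => h fun hBF : IsBFredholm _ => hz hBF.isTopologicalUniformDescent
  tfae_have 2 → 1 := isMeromorphicOperator_of_tudSpectrum_subset
  tfae_finish
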